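/- Theorem 1 (monotonicity of zeros). Let $q\in(0,1)$ and let $n\ge 0$ be an integer. For real $a,b$ with $0<aq<1$ and $bq<1$, let $$p_n(x;a,b|q)={}_2\phi_1\left(\begin{matrix}q^{-n},\,abq^{n+1}\\ aq\end{matrix};q,qx\right)=\sum_{k=0}^{n}\frac{(q^{-n};q)_k\,(abq^{n+1};q)_k}{(aq;q)_k\,(q;q)_k}\,(qx)^k,\qquad (c;q)_k=\prod_{j=0}^{k-1}(1-cq^j),$$ be the little $q$-Jacobi polynomial of degree $n$. All its zeros are real; list them with multiplicity as $\lambda_1(a,b)\le\dots\le\lambda_n(a,b)$. Then, for every $k\in\{1,\dots,n\}$: (1) for every fixed $a$ with $0<aq<1$, the zero $\lambda_k(a,b)$ is a strictly increasing function of $b\in(-\infty,1/q)$; (2) for every fixed $b$ with $bq<1$, the zero $\lambda_k(a,b)$ is a strictly decreasing function of $a\in(0,1/q)$. In particular, for real-rooted polynomials $p,r$ of degree $n$ with zeros $\lambda_1(p)\le\dots\le\lambda_n(p)$ and $\lambda_1(r)\le\dots\le\lambda_n(r)$ write $p\ll r$ if $\lambda_k(p)\le\lambda_k(r)$ for all $k=1,\dots,n$.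 Then for $0<a_1<a_2<1/q$ and $b_1<b_2<1/q$, $$p_n(x;a_2,b_1|q)\ll p_n(x;a_1,b_1|q)\ll p_n(x;a_1,b_2|q).$$ -/

import Mathlib

open Polynomial

noncomputable section

/-- The `q`-Pochhammer symbol `(a; q)_k = ∏_{j=0}^{k-1} (1 - a q^j)`. -/
def qPochhammer (a q : ℝ) (k : ℕ) : ℝ :=
  ∏ j ∈ Finset.range k, (1 - a * q ^ j)

/-- The terminating `q`-hypergeometric polynomial `₂φ₁(q^{-n}, α; β; q, x)` in the variable `x`.
For two upper parameters and one lower parameter, the factor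
`((-1)^k q^(k choose 2))^(s - r)` of the general series is `1`. -/
def qHypergeometric21 (q : ℝ) (n : ℕ) (α β : ℝ) : ℝ[X] :=
  ∑ k ∈ Finset.range (n + 1),
    C ((qPochhammer (q ^ (-(n : ℤ))) q k * qPochhammer α q k) /
      (qPochhammer β q k * qPochhammer q q k)) * X ^ k

/-- The little `q`-Jacobi polynomial
`p_n(x; a, b | q) = ₂φ₁(q^{-n}, a b q^{n+1}; a q; q, q x)`. -/
def littleQJacobi (q : ℝ) (n : ℕ) (a b : ℝ) : ℝ[X] :=
  (qHypergeometric21 q n (a * b * q ^ (n + 1)) (a * q)).comp (C q * X)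

/-- `p` has exact degree `n` and all its `n` complex zeros, counted with multiplicity, are real. -/
def RealRooted (n : ℕ) (p : ℝ[X]) : Prop :=
  p.degree = n ∧ p.Splits

/-- The real zeros of `p`, counted with multiplicity, enumerated in increasing order starting from
the index `0`. For a real-rooted `p` of degree `n`, this is the `(k+1)`-st smallest zero of `p`
when `k < n`; it has the default value `0` for larger indices. -/
def orderedZero (p : ℝ[X]) (k : ℕ) : ℝ :=
  (p.roots.sort (· ≤ ·)).getD k 0

/-- The partial order on real-rooted polynomials of degree `n`: the zeros of `p`, taken in
increasing order, are bounded one by one by those of `r`. -/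
def ZerosLE (n : ℕ) (p r : ℝ[X]) : Prop :=
  RealRooted n p ∧ RealRooted n r ∧ ∀ k < n, orderedZero p k ≤ orderedZero r k

end

/-! The polynomials are orthogonal for the positive masses `(aq)^j (bq; q)_j / (q; q)_j` at the
nodes `q^j`, so their zeros are real and simple, and Markov's monotonicity theorem applies to them.

Orthogonality (`isOrthogonal_littleQJacobi`): the moments are values of the `q`-binomial series,
whose functional equation makes them quotients of `q`-Pochhammer symbols. Integrating `p_n x^m` then
leaves a sum of `Q(q^k)` against the coefficients of `₁φ₀(q^{-n}; q, qz)` at `z = 1`, with `deg Q <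
n`. It vanishes because `₁φ₀(q^{-n}; q, z)` has zeros at `q, ..., q^n`.

Monotonicity (`orderedZero_lt_orderedZero`): no derivative in the parameter is needed. For weights
`w`, `W` with `W / w` larger at larger nodes, a test polynomial `f` built from zeros of both
orthogonal polynomials is integrated against `X - λ_k`. Gauss quadrature gives the signs, and
tilting from `w` to `W` makes one of them strict. Consecutive masses have quotient `aq(1 - bq^{j+1})
/ (1 - q^{j+1})`, which drops when `b` grows or `a` shrinks. Since the nodes decrease in `j`, mass
then moves to the right. -/

/-! ### `q`-Pochhammer symbols and the `q`-binomial series. -/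

theorem qPochhammer_zero (a q : ℝ) : qPochhammer a q 0 = 1 := by simp [qPochhammer]

theorem qPochhammer_succ (a q : ℝ) (k : ℕ) :
    qPochhammer a q (k + 1) = qPochhammer a q k * (1 - a * q ^ k) := by
  simp [qPochhammer, Finset.prod_range_succ]

theorem qPochhammer_add (a q : ℝ) (k m : ℕ) :
    qPochhammer a q (k + m) = qPochhammer a q k * qPochhammer (a * q ^ k) q m := by
  simp only [qPochhammer, Finset.prod_range_add]
  congr 1
  refine Finset.prod_congr rfl fun j _ => ?_
  ring

theorem qPochhammer_pos {a q : ℝ} (hq0 : 0 < q) (hq1 : q < 1) (ha : a < 1) (k : ℕ) :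
    0 < qPochhammer a q k := by
  refine Finset.prod_pos fun j _ => ?_
  have h0 : 0 < q ^ j := pow_pos hq0 j
  have h1 : q ^ j ≤ 1 := pow_le_one₀ hq0.le hq1.le
  rcases le_or_gt a 0 with h | h <;> nlinarith

theorem qPochhammer_q_neg_pow_eq_zero {q : ℝ} (hq0 : 0 < q) {n k : ℕ} (h : n < k) :
    qPochhammer (q ^ (-(n : ℤ))) q k = 0 := by
  refine Finset.prod_eq_zero (Finset.mem_range.2 h) ?_
  rw [zpow_neg, zpow_natCast, inv_mul_cancel₀ (pow_ne_zero _ hq0.ne'), sub_self]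

theorem qPochhammer_q_neg_pow_ne_zero {q : ℝ} (hq0 : 0 < q) (hq1 : q < 1) {n k : ℕ} (h : k ≤ n) :
    qPochhammer (q ^ (-(n : ℤ))) q k ≠ 0 := by
  refine Finset.prod_ne_zero_iff.2 fun j hj => ?_
  have hj := Finset.mem_range.1 hj
  rw [zpow_neg, zpow_natCast, sub_ne_zero]
  intro h1
  have : q ^ j = q ^ n := by
    have := pow_ne_zero n hq0.ne'
    field_simp at h1
    exact h1.symm
  have := pow_lt_pow_right_of_lt_one₀ hq0 hq1 (show j < n by omega)
  linarith

theorem one_sub_pow_succ_ne_zero {q : ℝ} (hq0 : 0 < q) (hq1 : q < 1) (k : ℕ) :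
    1 - q ^ (k + 1) ≠ 0 :=
  (sub_pos.2 (pow_lt_one₀ hq0.le hq1 (Nat.succ_ne_zero k))).ne'

/-- The coefficients `(β; q)_k / (q; q)_k` of the `q`-binomial series `₁φ₀(β; q, z)`. -/
noncomputable def qBinomialCoeff (q β : ℝ) (k : ℕ) : ℝ := qPochhammer β q k / qPochhammer q q k

theorem qBinomialCoeff_succ {q : ℝ} (hq0 : 0 < q) (hq1 : q < 1) (β : ℝ) (k : ℕ) :
    qBinomialCoeff q β (k + 1) * (1 - q ^ (k + 1)) = qBinomialCoeff q β k * (1 - β * q ^ k) := by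
  have h1 := (qPochhammer_pos hq0 hq1 hq1 k).ne'
  have h2 := one_sub_pow_succ_ne_zero hq0 hq1 k
  rw [pow_succ'] at h2 ⊢
  rw [qBinomialCoeff, qBinomialCoeff, qPochhammer_succ, qPochhammer_succ, div_mul_eq_mul_div,
    div_mul_eq_mul_div, div_eq_div_iff (mul_ne_zero h1 h2) h1]
  ring

theorem summable_qBinomial {q : ℝ} (hq0 : 0 < q) (hq1 : q < 1) (β : ℝ) {z : ℝ} (hz : |z| < 1) :
    Summable fun k => qBinomialCoeff q β k * z ^ k := by
  obtain ⟨r, hr, hr1⟩ := exists_between hz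
  refine summable_of_ratio_norm_eventually_le (r := r) hr1 ?_
  have hp := tendsto_pow_atTop_nhds_zero_of_lt_one hq0.le hq1
  -- Ratio test: the quotient of consecutive terms tends to `z`.
  have ht : Filter.Tendsto (fun k : ℕ => |(1 - β * q ^ k) / (1 - q * q ^ k) * z|) Filter.atTop
      (nhds |(1 - β * 0) / (1 - q * 0) * z|) := by
    refine Filter.Tendsto.abs (Filter.Tendsto.mul_const _ (Filter.Tendsto.div ?_ ?_ (by simp)))
    · exact tendsto_const_nhds.sub (hp.const_mul β)
    · exact tendsto_const_nhds.sub (hp.const_mul q)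
  have hlt : |(1 - β * 0) / (1 - q * 0) * z| < r := by simpa using hr
  filter_upwards [ht.eventually (gt_mem_nhds hlt)] with k hk
  have h2 := one_sub_pow_succ_ne_zero hq0 hq1 k
  have h3 : qBinomialCoeff q β (k + 1) * z ^ (k + 1) =
      ((1 - β * q ^ k) / (1 - q * q ^ k) * z) * (qBinomialCoeff q β k * z ^ k) := by
    have := qBinomialCoeff_succ hq0 hq1 β k
    rw [← pow_succ']
    field_simp
    linear_combination z * z ^ k * this
  rw [h3, norm_mul, Real.norm_eq_abs]
  exact mul_le_mul_of_nonneg_right hk.le (norm_nonneg _)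

/-- The `q`-binomial series `₁φ₀(β; q, z)`. -/
noncomputable def qBinomialSeries (q β z : ℝ) : ℝ := ∑' k, qBinomialCoeff q β k * z ^ k

/-- Writing `F` for the series, `F(z) - F(qz)` and `F(z) - βF(qz)` multiply the coefficients by `1 -
q^k` and `1 - βq^k`. The coefficient recurrence says that the first is `z` times the second. -/
theorem qBinomialSeries_functional {q : ℝ} (hq0 : 0 < q) (hq1 : q < 1) (β : ℝ) {z : ℝ}
    (hz : |z| < 1) :
    (1 - z) * qBinomialSeries q β z = (1 - β * z) * qBinomialSeries q β (q * z) := by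
  have hz' : |q * z| < 1 := by
    rw [abs_mul, abs_of_pos hq0]
    nlinarith [abs_nonneg z]
  have s1 := summable_qBinomial hq0 hq1 β hz
  have s2 := summable_qBinomial hq0 hq1 β hz'
  have h1 : qBinomialSeries q β z - qBinomialSeries q β (q * z) =
      ∑' k, qBinomialCoeff q β k * (1 - q ^ k) * z ^ k := by
    rw [qBinomialSeries, qBinomialSeries, ← s1.tsum_sub s2]
    refine tsum_congr fun k => ?_
    rw [mul_pow]; ring
  have h2 : qBinomialSeries q β z - β * qBinomialSeries q β (q * z) =
      ∑' k, qBinomialCoeff q β k * (1 - β * q ^ k) * z ^ k := by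
    rw [qBinomialSeries, qBinomialSeries, ← tsum_mul_left, ← s1.tsum_sub (s2.mul_left β)]
    refine tsum_congr fun k => ?_
    rw [mul_pow]; ring
  have s3 : Summable fun k => qBinomialCoeff q β k * (1 - q ^ k) * z ^ k := by
    refine (s1.sub s2).congr fun k => ?_
    rw [mul_pow]; ring
  have h3 : ∑' k, qBinomialCoeff q β k * (1 - q ^ k) * z ^ k =
      z * ∑' k, qBinomialCoeff q β k * (1 - β * q ^ k) * z ^ k := by
    rw [s3.tsum_eq_zero_add, ← tsum_mul_left]
    simp only [pow_zero, sub_self, mul_zero, zero_mul, zero_add]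
    refine tsum_congr fun k => ?_
    rw [qBinomialCoeff_succ hq0 hq1]; ring
  rw [← h1, ← h2] at h3
  linear_combination h3

theorem qBinomialSeries_q_neg_pow {q : ℝ} (hq0 : 0 < q) (n : ℕ) (z : ℝ) :
    qBinomialSeries q (q ^ (-(n : ℤ))) z =
      ∑ k ∈ Finset.range (n + 1), qBinomialCoeff q (q ^ (-(n : ℤ))) k * z ^ k := by
  refine tsum_eq_sum fun k hk => ?_
  rw [qBinomialCoeff, qPochhammer_q_neg_pow_eq_zero hq0 (by simpa using hk)]
  simp

/-- At `z = q^n` the factor `1 - q^{-n} z` of the functional equation vanishes. The equation then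
carries each zero from `qz` down to `z`, so the induction runs on the distance of `r` from `n - 1`.
-/
theorem qBinomialSeries_q_neg_pow_eq_zero {q : ℝ} (hq0 : 0 < q) (hq1 : q < 1) {n r : ℕ}
    (hr : r < n) : qBinomialSeries q (q ^ (-(n : ℤ))) (q ^ (r + 1)) = 0 := by
  have hlt : ∀ r : ℕ, q ^ (r + 1) < 1 := fun r => pow_lt_one₀ hq0.le hq1 (Nat.succ_ne_zero r)
  have habs : ∀ r : ℕ, |q ^ (r + 1)| < 1 := fun r => by
    rw [abs_of_pos (pow_pos hq0 _)]; exact hlt r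
  induction hd : n - 1 - r generalizing r with
  | zero =>
    have h := qBinomialSeries_functional hq0 hq1 (q ^ (-(n : ℤ))) (habs r)
    have hrn : r + 1 = n := by omega
    rw [show q ^ (-(n : ℤ)) * q ^ (r + 1) = 1 by
      rw [hrn, zpow_neg, zpow_natCast, inv_mul_cancel₀ (pow_ne_zero _ hq0.ne')]] at h
    rw [sub_self, zero_mul] at h
    exact (mul_eq_zero.1 h).resolve_left (by linarith [hlt r])
  | succ d ih =>
    have h := qBinomialSeries_functional hq0 hq1 (q ^ (-(n : ℤ))) (habs r)
    rw [← pow_succ', ih (r := r + 1) (by omega) (by omega), mul_zero] at h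
    exact (mul_eq_zero.1 h).resolve_left (by linarith [hlt r])

/-- By linearity: the monomial `X ^ r` turns the sum into the terminating series at `q^{r+1}`. -/
theorem sum_qBinomialCoeff_eval_eq_zero {q : ℝ} (hq0 : 0 < q) (hq1 : q < 1) {n : ℕ} {f : ℝ[X]}
    (hf : f.natDegree < n) :
    ∑ k ∈ Finset.range (n + 1),
      qBinomialCoeff q (q ^ (-(n : ℤ))) k * q ^ k * f.eval (q ^ k) = 0 := by
  simp_rw [eval_eq_sum_range, Finset.mul_sum]
  rw [Finset.sum_comm]
  refine Finset.sum_eq_zero fun r hr => ?_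
  have hr : r < n := by have := Finset.mem_range.1 hr; omega
  have h := qBinomialSeries_q_neg_pow_eq_zero hq0 hq1 hr
  rw [qBinomialSeries_q_neg_pow hq0] at h
  rw [← mul_zero (f.coeff r), ← h, Finset.mul_sum]
  refine Finset.sum_congr rfl fun k _ => ?_
  rw [← pow_mul, ← pow_mul]
  ring

/-! ### Discrete measures; real and simple zeros of orthogonal polynomials. -/

/-- The linear functional `f ↦ ∑ w_j f(x_j)` of a discrete measure with nodes `x` and masses `w`. -/
noncomputable def discreteFunctional (x w : ℕ → ℝ) (f : ℝ[X]) : ℝ := ∑' j, w j * f.eval (x j)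

/-- All moments of the discrete measure with nodes `x` and masses `w` converge absolutely. -/
def HasMoments (x w : ℕ → ℝ) : Prop := ∀ m : ℕ, Summable fun j => w j * x j ^ m

/-- `p` is orthogonal to all polynomials of smaller degree. -/
def IsOrthogonal (x w : ℕ → ℝ) (p : ℝ[X]) : Prop :=
  ∀ f : ℝ[X], f.degree < p.degree → discreteFunctional x w (p * f) = 0

section

variable {x w : ℕ → ℝ}

theorem HasMoments.summable (hm : HasMoments x w) (f : ℝ[X]) :
    Summable fun j => w j * f.eval (x j) := by
  simp_rw [eval_eq_sum_range, Finset.mul_sum]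
  refine summable_sum fun i _ => ((hm i).mul_left (f.coeff i)).congr fun j => ?_
  ring

theorem HasMoments.map_add (hm : HasMoments x w) (f g : ℝ[X]) :
    discreteFunctional x w (f + g) = discreteFunctional x w f + discreteFunctional x w g := by
  simp only [discreteFunctional]
  rw [← (hm.summable f).tsum_add (hm.summable g)]
  refine tsum_congr fun j => ?_
  rw [eval_add, mul_add]

theorem discreteFunctional_C_mul (c : ℝ) (f : ℝ[X]) :
    discreteFunctional x w (C c * f) = c * discreteFunctional x w f := by
  simp only [discreteFunctional]
  rw [← tsum_mul_left]
  refine tsum_congr fun j => ?_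
  rw [eval_mul, eval_C]; ring

theorem discreteFunctional_zero : discreteFunctional x w 0 = 0 := by
  simp [discreteFunctional]

theorem HasMoments.map_sum (hm : HasMoments x w) {ι : Type*} (s : Finset ι) (f : ι → ℝ[X]) :
    discreteFunctional x w (∑ i ∈ s, f i) = ∑ i ∈ s, discreteFunctional x w (f i) := by
  classical
  induction s using Finset.induction_on with
  | empty => simp [discreteFunctional_zero]
  | insert i s hi ih => rw [Finset.sum_insert hi, Finset.sum_insert hi, hm.map_add, ih]

/-- Infinitely many nodes are distinct, and only finitely many are zeros of `f`. One index `N` is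
excluded because in the tilting argument the difference of weights vanishes there. -/
theorem exists_notMem_eval_ne_zero (hx : Function.Injective x) {f : ℝ[X]} (hf : f ≠ 0)
    (N : ℕ) : ∃ j, j ≠ N ∧ f.eval (x j) ≠ 0 := by
  have hfin : (x ⁻¹' (f.roots.toFinset : Set ℝ) ∪ {N}).Finite :=
    (f.roots.toFinset.finite_toSet.preimage hx.injOn).union (Set.finite_singleton N)
  obtain ⟨j, hj⟩ := hfin.exists_notMem
  refine ⟨j, fun h => hj (Or.inr h), fun h => hj (Or.inl ?_)⟩
  simpa [hf] using h

theorem HasMoments.pos (hm : HasMoments x w) (hx : Function.Injective x) (hw : ∀ j, 0 < w j)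
    {f : ℝ[X]} (hf : f ≠ 0) (hf0 : ∀ j, 0 ≤ f.eval (x j)) : 0 < discreteFunctional x w f := by
  obtain ⟨j, -, hj⟩ := exists_notMem_eval_ne_zero hx hf 0
  exact (hm.summable f).tsum_pos (fun i => mul_nonneg (hw i).le (hf0 i)) j
    (mul_pos (hw j) ((hf0 j).lt_of_ne' hj))

/-- An orthogonal polynomial has no factor of positive degree that is nonnegative on the line. -/
theorem IsOrthogonal.degree_eq_zero_of_nonneg_dvd {p : ℝ[X]} (ho : IsOrthogonal x w p)
    (hm : HasMoments x w) (hx : Function.Injective x) (hw : ∀ j, 0 < w j) (hp : p ≠ 0)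
    {s : ℝ[X]} (hs : ∀ y, 0 ≤ s.eval y) (hd : s ∣ p) : s.natDegree = 0 := by
  -- With `p = s h`, the product `p h = s h²` is nonnegative. If `s` were nonconstant, `h` would
  -- have smaller degree than `p`, and orthogonality would contradict positivity.
  obtain ⟨h, rfl⟩ := hd
  by_contra hs0
  have hne := mul_ne_zero_iff.1 hp
  have hdeg : h.degree < (s * h).degree := by
    rw [degree_eq_natDegree hp, degree_eq_natDegree hne.2, natDegree_mul hne.1 hne.2]
    exact_mod_cast by omega
  have := ho h hdeg
  refine (hm.pos hx hw (mul_ne_zero hp hne.2) fun j => ?_).ne' this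
  rw [eval_mul, eval_mul, mul_assoc]
  exact mul_nonneg (hs _) (mul_self_nonneg _)

theorem IsOrthogonal.nodup_roots {p : ℝ[X]} (ho : IsOrthogonal x w p)
    (hm : HasMoments x w) (hx : Function.Injective x) (hw : ∀ j, 0 < w j) (hp : p ≠ 0) :
    p.roots.Nodup := by
  rw [Multiset.nodup_iff_count_le_one]
  intro r
  rw [count_roots]
  by_contra! h
  have hd : (X - C r) ^ 2 ∣ p := (le_rootMultiplicity_iff hp).1 h
  have := ho.degree_eq_zero_of_nonneg_dvd hm hx hw hp (fun y => by simpa using sq_nonneg (y - r)) hd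
  rw [natDegree_pow, natDegree_X_sub_C] at this
  omega

theorem IsOrthogonal.splits {p : ℝ[X]} (ho : IsOrthogonal x w p)
    (hm : HasMoments x w) (hx : Function.Injective x) (hw : ∀ j, 0 < w j) (hp : p ≠ 0) :
    p.Splits := by
  suffices h : ∀ g : ℝ[X], Irreducible g → g ∣ p → g.degree = 1 by
    obtain ⟨u, hu⟩ := UniqueFactorizationMonoid.factors_prod hp
    rw [← hu]
    refine (Splits.multisetProd fun g hg => ?_).mul u.isUnit.splits
    exact Splits.of_degree_eq_one (h g (UniqueFactorizationMonoid.irreducible_of_factor g hg)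
      (UniqueFactorizationMonoid.dvd_of_mem_factors hg))
  intro g hirr hgp
  obtain ⟨z, hz⟩ := IsAlgClosed.exists_aeval_eq_zero ℂ g hirr.degree_pos.ne'
  by_cases him : z.im = 0
  · have hz' : z = algebraMap ℝ ℂ z.re := by
      apply Complex.ext <;> simp [him]
    rw [hz', aeval_algebraMap_apply, map_eq_zero] at hz
    exact degree_eq_one_of_irreducible_of_root hirr hz
  · exfalso
    -- A nonreal zero yields the real factor `(X - Re z)² + (Im z)²`, which is nonnegative on the
    -- line.
    have hd := (g.quadratic_dvd_of_aeval_eq_zero_im_ne_zero hz him).trans hgp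
    have := ho.degree_eq_zero_of_nonneg_dvd hm hx hw hp (fun y => ?_) hd
    · have h2 : (X ^ 2 - C (2 * z.re) * X + C (‖z‖ ^ 2)).natDegree = 2 := by compute_degree!
      omega
    · have : ‖z‖ ^ 2 = z.re ^ 2 + z.im ^ 2 := by
        rw [← Complex.normSq_eq_norm_sq, Complex.normSq_apply]; ring
      simp only [eval_add, eval_sub, eval_mul, eval_pow, eval_X, eval_C, this]
      nlinarith [sq_nonneg (y - z.re), sq_nonneg z.im]

/-! ### Gauss quadrature and tilting of measures. -/

/-- Gauss quadrature with nodes at the zeros of an orthogonal polynomial. -/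
theorem IsOrthogonal.quadrature {p : ℝ[X]} (ho : IsOrthogonal x w p)
    (hm : HasMoments x w) (hs : p.Splits) (hn : p.roots.Nodup) (hp : p ≠ 0)
    {f : ℝ[X]} (hf : f.natDegree < 2 * p.natDegree) :
    discreteFunctional x w f = ∑ r ∈ p.roots.toFinset,
      f.eval r * discreteFunctional x w (Lagrange.basis p.roots.toFinset id r) := by
  have hcard : (p.roots.toFinset.card : WithBot ℕ) = p.degree := by
    rw [degree_eq_natDegree hp, Multiset.toFinset_card_of_nodup hn, hs.natDegree_eq_card_roots]
  -- The remainder agrees with `f` at the zeros of `p`, hence is its interpolant; the quotient has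
  -- degree below that of `p`, so orthogonality removes it.
  have hmod : f % p = Lagrange.interpolate p.roots.toFinset id fun r => f.eval r := by
    refine Lagrange.eq_interpolate_of_eval_eq _ Function.injective_id.injOn ?_ fun r hr => ?_
    · rw [hcard]; exact degree_mod_lt f hp
    · have hr : p.eval r = 0 := by simpa [hp] using hr
      rw [id]
      conv_rhs => rw [← EuclideanDomain.div_add_mod f p]
      simp [hr]
  have hdiv : (f / p).degree < p.degree := by
    by_cases h0 : f / p = 0
    · rw [h0, degree_zero, bot_lt_iff_ne_bot]; exact degree_ne_bot.2 hp
    have hle : p.degree ≤ f.degree := not_lt.1 fun hlt => h0 ((Polynomial.div_eq_zero_iff hp).2 hlt)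
    have hf0 : f ≠ 0 := by rintro rfl; simp at h0
    have hadd := degree_add_div hp hle
    rw [degree_eq_natDegree h0, degree_eq_natDegree hp, degree_eq_natDegree hf0] at hadd
    rw [degree_eq_natDegree h0, degree_eq_natDegree hp, Nat.cast_lt]
    have : p.natDegree + (f / p).natDegree = f.natDegree := by exact_mod_cast hadd
    omega
  conv_lhs => rw [← EuclideanDomain.div_add_mod f p]
  rw [hm.map_add, ho _ hdiv, zero_add, hmod, Lagrange.interpolate_apply, hm.map_sum]
  simp only [discreteFunctional_C_mul]

/-- Quadrature is exact on the square of a basis polynomial and only the node `r` contributes, so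
the quadrature weight is the integral of a square. -/
theorem IsOrthogonal.christoffel_pos {p : ℝ[X]} (ho : IsOrthogonal x w p)
    (hm : HasMoments x w) (hx : Function.Injective x) (hw : ∀ j, 0 < w j)
    (hs : p.Splits) (hn : p.roots.Nodup) (hp : p ≠ 0) {r : ℝ} (hr : r ∈ p.roots.toFinset) :
    0 < discreteFunctional x w (Lagrange.basis p.roots.toFinset id r) := by
  have hinj : Set.InjOn (id : ℝ → ℝ) p.roots.toFinset := Function.injective_id.injOn
  have hne := Lagrange.basis_ne_zero hinj hr
  have hpos : 0 < p.roots.toFinset.card := Finset.card_pos.2 ⟨r, hr⟩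
  have h := ho.quadrature hm hs hn hp (f := Lagrange.basis p.roots.toFinset id r ^ 2) (by
    rw [natDegree_pow, Lagrange.natDegree_basis hinj hr, hs.natDegree_eq_card_roots,
      ← Multiset.toFinset_card_of_nodup hn]
    omega)
  rw [Finset.sum_eq_single r (fun t ht htr => by
    have := Lagrange.eval_basis_of_ne (v := (id : ℝ → ℝ)) htr.symm ht
    rw [id] at this
    simp [this]) (fun h => absurd hr h)] at h
  have h1 := Lagrange.eval_basis_self hinj hr
  rw [id] at h1
  rw [eval_pow, h1, one_pow, one_mul] at h
  rw [← h]
  exact hm.pos hx hw (pow_ne_zero 2 hne) fun j => by rw [eval_pow]; exact sq_nonneg _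

theorem IsOrthogonal.nonneg_of_nonneg_on_roots {p : ℝ[X]} (ho : IsOrthogonal x w p)
    (hm : HasMoments x w) (hx : Function.Injective x) (hw : ∀ j, 0 < w j) (hp : p ≠ 0)
    {f : ℝ[X]} (hf : f.natDegree < 2 * p.natDegree) (h : ∀ r ∈ p.roots, 0 ≤ f.eval r) :
    0 ≤ discreteFunctional x w f := by
  have hs := ho.splits hm hx hw hp
  have hn := ho.nodup_roots hm hx hw hp
  rw [ho.quadrature hm hs hn hp hf]
  exact Finset.sum_nonneg fun r hr => mul_nonneg (h r (Multiset.mem_toFinset.1 hr))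
    (ho.christoffel_pos hm hx hw hs hn hp hr).le

/-- Tilting a discrete measure towards larger nodes increases the integral of `(X - t) f²`. -/
theorem pos_of_strictAnti_ratio {W : ℕ → ℝ} (hx : StrictAnti x) (hm : HasMoments x w)
    (hM : HasMoments x W) (hw : ∀ j, 0 < w j) (hW : ∀ j, 0 < W j)
    (hr : StrictAnti fun j => W j / w j) {t : ℝ} {f : ℝ[X]} (hf : f ≠ 0)
    (h : 0 ≤ discreteFunctional x w ((X - C t) * f ^ 2)) :
    0 < discreteFunctional x W ((X - C t) * f ^ 2) := by
  have hne : (X - C t) * f ^ 2 ≠ 0 := mul_ne_zero (X_sub_C_ne_zero t) (pow_ne_zero 2 hf)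
  have hev : ∀ j, ((X - C t) * f ^ 2).eval (x j) = (x j - t) * f.eval (x j) ^ 2 := by simp
  by_cases hN : ∃ j, x j ≤ t
  · classical
    let N := Nat.find hN
    have hNt : x N ≤ t := Nat.find_spec hN
    have hlt : ∀ j < N, t < x j := fun j hj => not_le.1 (Nat.find_min hN hj)
    -- `N` is the first index with node at most `t`. Both `W / w - c` and `x - t` change sign at `N`
    -- in the same direction, so `(W - c w)(x - t)` is never negative.
    set c := W N / w N with hc
    have hc0 : 0 < c := div_pos (hW N) (hw N)
    have key : ∀ j, 0 ≤ (W j - c * w j) * (x j - t) := fun j => by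
      have hj : W j = W j / w j * w j := (div_mul_cancel₀ _ (hw j).ne').symm
      rcases lt_or_ge j N with hjN | hjN
      · have h1 : c < W j / w j := hr hjN
        refine mul_nonneg ?_ (sub_pos.2 (hlt j hjN)).le
        rw [hj, ← sub_mul]
        exact mul_nonneg (sub_pos.2 h1).le (hw j).le
      · have h1 : W j / w j ≤ c := hr.antitone hjN
        have h2 : x j ≤ t := (hx.antitone hjN).trans hNt
        refine mul_nonneg_of_nonpos_of_nonpos ?_ (sub_nonpos.2 h2)
        rw [hj, ← sub_mul]
        exact mul_nonpos_of_nonpos_of_nonneg (sub_nonpos.2 h1) (hw j).le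
    obtain ⟨j, hjN, hj⟩ := exists_notMem_eval_ne_zero hx.injective hne N
    have hcw : W j - c * w j ≠ 0 := by
      intro h0
      have : W j / w j = c := by rw [div_eq_iff (hw j).ne']; linarith
      exact hjN (hr.injective this)
    have hsum := ((hM.summable ((X - C t) * f ^ 2)).sub
      ((hm.summable ((X - C t) * f ^ 2)).mul_left c))
    have hpos := hsum.tsum_pos (fun j => by
      rw [hev]; nlinarith [mul_nonneg (key j) (sq_nonneg (f.eval (x j)))]) j (by
      refine lt_of_le_of_ne ?_ ?_
      · rw [hev]; nlinarith [mul_nonneg (key j) (sq_nonneg (f.eval (x j)))]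
      · rw [← mul_assoc, ← sub_mul]
        exact (mul_ne_zero hcw hj).symm)
    rw [(hM.summable _).tsum_sub ((hm.summable _).mul_left c), tsum_mul_left] at hpos
    have h2 := mul_nonneg hc0.le h
    simp only [discreteFunctional] at h2 ⊢
    linarith
  · push Not at hN
    refine hM.pos hx.injective hW hne fun j => ?_
    rw [hev]
    exact mul_nonneg (sub_pos.2 (hN j)).le (sq_nonneg _)

end

/-! ### Ordered zeros and Markov's theorem. -/

theorem length_sort_roots {p : ℝ[X]} (hs : p.Splits) :
    (p.roots.sort (· ≤ ·)).length = p.natDegree := by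
  rw [Multiset.length_sort, hs.natDegree_eq_card_roots]

theorem orderedZero_eq_getElem {p : ℝ[X]} {k : ℕ} (hk : k < (p.roots.sort (· ≤ ·)).length) :
    orderedZero p k = (p.roots.sort (· ≤ ·))[k] := by
  rw [orderedZero, List.getD_eq_getElem _ _ hk]

theorem orderedZero_le_orderedZero {p : ℝ[X]} (hs : p.Splits) {i k : ℕ} (hik : i ≤ k)
    (hk : k < p.natDegree) : orderedZero p i ≤ orderedZero p k := by
  rw [← length_sort_roots hs] at hk
  rw [orderedZero_eq_getElem hk, orderedZero_eq_getElem (hik.trans_lt hk)]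
  exact (Multiset.pairwise_sort p.roots (· ≤ ·)).sortedLE.monotone_get (a := ⟨i, _⟩) (b := ⟨k, hk⟩) hik

theorem exists_orderedZero_eq {p : ℝ[X]} (hs : p.Splits) {r : ℝ} (hr : r ∈ p.roots) :
    ∃ i < p.natDegree, orderedZero p i = r := by
  obtain ⟨i, hi, h⟩ := List.getElem_of_mem ((Multiset.mem_sort (r := (· ≤ ·))).2 hr)
  exact ⟨i, length_sort_roots hs ▸ hi, by rw [orderedZero_eq_getElem hi, h]⟩

/-- Markov's theorem: moving the mass of a discrete measure towards larger nodes increases all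
zeros of its orthogonal polynomials. -/
theorem orderedZero_lt_orderedZero {x w W : ℕ → ℝ} {n : ℕ} (hx : StrictAnti x)
    (hm : HasMoments x w) (hM : HasMoments x W) (hw : ∀ j, 0 < w j) (hW : ∀ j, 0 < W j)
    (hr : StrictAnti fun j => W j / w j) {p P : ℝ[X]} (hp : p.degree = n) (hP : P.degree = n)
    (ho : IsOrthogonal x w p) (hO : IsOrthogonal x W P) {k : ℕ} (hk : k < n) :
    orderedZero p k < orderedZero P k := by
  have hp0 : p ≠ 0 := by rintro rfl; simp at hp
  have hP0 : P ≠ 0 := by rintro rfl; simp at hP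
  have hpn : p.natDegree = n := natDegree_eq_of_degree_eq_some hp
  have hPn : P.natDegree = n := natDegree_eq_of_degree_eq_some hP
  have hs := ho.splits hm hx.injective hw hp0
  have hS := hO.splits hM hx.injective hW hP0
  -- `f` vanishes at the zeros of `p` below index `k` and at those of `P` above it. Hence `(X - λ_k)
  -- f²` is nonnegative at all zeros of `p` for `λ_k` of `p`, and nonpositive at all zeros of `P`
  -- for `λ_k` of `P`. Its degree `2n - 1` is the largest for which quadrature is exact.
  set f : ℝ[X] := (∏ i ∈ Finset.range k, (X - C (orderedZero p i))) *
    ∏ i ∈ Finset.Ioo k n, (X - C (orderedZero P i)) with hf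
  have hm1 : (∏ i ∈ Finset.range k, (X - C (orderedZero p i))).Monic :=
    monic_prod_of_monic _ _ fun i _ => monic_X_sub_C _
  have hm2 : (∏ i ∈ Finset.Ioo k n, (X - C (orderedZero P i))).Monic :=
    monic_prod_of_monic _ _ fun i _ => monic_X_sub_C _
  have hf0 : f ≠ 0 := (hm1.mul hm2).ne_zero
  have hfd : f.natDegree = n - 1 := by
    rw [hf, hm1.natDegree_mul hm2, natDegree_prod_of_monic _ _ fun i _ => monic_X_sub_C _,
      natDegree_prod_of_monic _ _ fun i _ => monic_X_sub_C _]
    simp only [natDegree_X_sub_C, Finset.sum_const, Finset.card_range, Nat.card_Ioo, smul_eq_mul]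
    omega
  have hdeg : ∀ t : ℝ, ((X - C t) * f ^ 2).natDegree = 2 * n - 1 := fun t => by
    rw [natDegree_mul (X_sub_C_ne_zero t) (pow_ne_zero 2 hf0), natDegree_X_sub_C, natDegree_pow,
      hfd]
    omega
  have hl : 0 ≤ discreteFunctional x w ((X - C (orderedZero p k)) * f ^ 2) := by
    refine ho.nonneg_of_nonneg_on_roots hm hx.injective hw hp0 (by rw [hdeg, hpn]; omega)
      fun r hr => ?_
    obtain ⟨i, hi, rfl⟩ := exists_orderedZero_eq hs hr
    rw [eval_mul, eval_pow]
    rcases lt_or_ge i k with hik | hik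
    · have : f.eval (orderedZero p i) = 0 := by
        rw [hf, eval_mul, eval_prod, Finset.prod_eq_zero (Finset.mem_range.2 hik) (by simp),
          zero_mul]
      rw [this]; simp
    · refine mul_nonneg ?_ (sq_nonneg _)
      rw [eval_sub, eval_X, eval_C]
      exact sub_nonneg.2 (orderedZero_le_orderedZero hs hik hi)
  have hu : 0 ≤ discreteFunctional x W (C (-1) * ((X - C (orderedZero P k)) * f ^ 2)) := by
    refine hO.nonneg_of_nonneg_on_roots hM hx.injective hW hP0
      (by rw [natDegree_C_mul (by norm_num), hdeg, hPn]; omega) fun r hr => ?_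
    obtain ⟨i, hi, rfl⟩ := exists_orderedZero_eq hS hr
    rw [eval_mul, eval_mul, eval_pow]
    rcases lt_or_ge k i with hik | hik
    · have : f.eval (orderedZero P i) = 0 := by
        rw [hf, eval_mul, eval_prod (Finset.Ioo k n),
          Finset.prod_eq_zero (Finset.mem_Ioo.2 ⟨hik, hPn ▸ hi⟩) (by simp), mul_zero]
      rw [this]; simp
    · have h1 := orderedZero_le_orderedZero hS hik (hPn ▸ hk)
      simp only [eval_sub, eval_X, eval_C]
      nlinarith [mul_nonneg (sub_nonneg.2 h1) (sq_nonneg (f.eval (orderedZero P i)))]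
  have hl' := pos_of_strictAnti_ratio hx hm hM hw hW hr hf0 hl
  have hff := hM.pos hx.injective hW (pow_ne_zero 2 hf0) fun j => by
    rw [eval_pow]; exact sq_nonneg _
  rw [discreteFunctional_C_mul] at hu
  -- Subtracting the two integrals against `W` leaves `λ_k(P) - λ_k(p)` times the positive integral
  -- of `f²`.
  have hsplit : (X - C (orderedZero p k)) * f ^ 2 = (X - C (orderedZero P k)) * f ^ 2 +
      C (orderedZero P k - orderedZero p k) * f ^ 2 := by
    rw [C_sub]; ring
  rw [hsplit, hM.map_add, discreteFunctional_C_mul] at hl'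
  by_contra! hle
  nlinarith [mul_nonneg (sub_nonneg.2 hle) hff.le]

/-! ### Orthogonality of the little `q`-Jacobi polynomials. -/

/-- The masses `(aq)^j (bq; q)_j / (q; q)_j` of the orthogonality measure of the little `q`-Jacobi
polynomials at the nodes `q^j`. -/
noncomputable def littleQJacobiWeight (q a b : ℝ) (j : ℕ) : ℝ :=
  qBinomialCoeff q (b * q) j * (a * q) ^ j

section

variable {q a b : ℝ}

theorem littleQJacobiWeight_pos (hq0 : 0 < q) (hq1 : q < 1) (ha : 0 < a * q) (hb : b * q < 1)
    (j : ℕ) : 0 < littleQJacobiWeight q a b j :=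
  mul_pos (div_pos (qPochhammer_pos hq0 hq1 hb j) (qPochhammer_pos hq0 hq1 hq1 j)) (pow_pos ha j)

/-- The factor `(q^j)^m` only replaces `aq` by `aq^{m+1}`, so every moment is a value of the same
`q`-binomial series. -/
theorem littleQJacobiWeight_mul_pow (m j : ℕ) :
    littleQJacobiWeight q a b j * (q ^ j) ^ m =
      qBinomialCoeff q (b * q) j * (a * q ^ (m + 1)) ^ j := by
  rw [littleQJacobiWeight, mul_assoc, ← pow_mul, mul_comm j m, pow_mul, ← mul_pow]
  congr 2
  ring

theorem abs_mul_pow_succ_lt_one (hq0 : 0 < q) (hq1 : q < 1) (ha : 0 < a * q) (ha1 : a * q < 1)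
    (m : ℕ) : |a * q ^ (m + 1)| < 1 := by
  have h0 : 0 < q ^ m := pow_pos hq0 m
  have h1 : q ^ m ≤ 1 := pow_le_one₀ hq0.le hq1.le
  rw [pow_succ', ← mul_assoc, abs_of_pos (mul_pos ha h0)]
  nlinarith

theorem hasMoments_littleQJacobiWeight (hq0 : 0 < q) (hq1 : q < 1) (ha : 0 < a * q)
    (ha1 : a * q < 1) (b : ℝ) :
    HasMoments (fun j => q ^ j) (littleQJacobiWeight q a b) := fun m => by
  simp only [littleQJacobiWeight_mul_pow]
  exact summable_qBinomial hq0 hq1 _ (abs_mul_pow_succ_lt_one hq0 hq1 ha ha1 m)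

theorem discreteFunctional_littleQJacobiWeight_X_pow (m : ℕ) :
    discreteFunctional (fun j => q ^ j) (littleQJacobiWeight q a b) (X ^ m) =
      qBinomialSeries q (b * q) (a * q ^ (m + 1)) := by
  simp only [discreteFunctional, eval_pow, eval_X, littleQJacobiWeight_mul_pow, qBinomialSeries]

theorem mul_mul_sq_lt_one (ha : 0 < a * q) (ha1 : a * q < 1)
    (hb : b * q < 1) : a * b * q ^ 2 < 1 := by
  have : a * b * q ^ 2 = (a * q) * (b * q) := by ring
  rw [this]
  nlinarith

theorem mul_mul_pow_lt_one (hq0 : 0 < q) (hq1 : q < 1) (ha : 0 < a * q) (ha1 : a * q < 1)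
    (hb : b * q < 1) (m : ℕ) : a * b * q ^ 2 * q ^ m < 1 := by
  have h := mul_mul_sq_lt_one ha ha1 hb
  have h0 : 0 < q ^ m := pow_pos hq0 m
  have h1 : q ^ m ≤ 1 := pow_le_one₀ hq0.le hq1.le
  rcases le_or_gt (a * b * q ^ 2) 0 with h2 | h2 <;> nlinarith

/-- The moments of the little `q`-Jacobi weight. -/
theorem littleQJacobi_moment (hq0 : 0 < q) (hq1 : q < 1) (ha : 0 < a * q) (ha1 : a * q < 1)
    (b : ℝ) (m : ℕ) :
    qPochhammer (a * b * q ^ 2) q m *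
        discreteFunctional (fun j => q ^ j) (littleQJacobiWeight q a b) (X ^ m) =
      qPochhammer (a * q) q m *
        discreteFunctional (fun j => q ^ j) (littleQJacobiWeight q a b) 1 := by
  induction m with
  | zero => simp [qPochhammer_zero]
  | succ m ih =>
    have h := qBinomialSeries_functional hq0 hq1 (b * q)
      (abs_mul_pow_succ_lt_one hq0 hq1 ha ha1 m)
    rw [show q * (a * q ^ (m + 1)) = a * q ^ (m + 1 + 1) by ring,
      ← discreteFunctional_littleQJacobiWeight_X_pow,
      ← discreteFunctional_littleQJacobiWeight_X_pow] at h
    rw [qPochhammer_succ, qPochhammer_succ]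
    linear_combination (1 - a * q * q ^ m) * ih - qPochhammer (a * b * q ^ 2) q m * h

theorem coeff_littleQJacobi (q : ℝ) (n : ℕ) (a b : ℝ) (k : ℕ) (hk : k ≤ n) :
    (littleQJacobi q n a b).coeff k =
      (qPochhammer (q ^ (-(n : ℤ))) q k * qPochhammer (a * b * q ^ (n + 1)) q k) /
      (qPochhammer (a * q) q k * qPochhammer q q k) * q ^ k := by
  rw [littleQJacobi, comp_C_mul_X_coeff, qHypergeometric21, finsetSum_coeff]
  simp only [coeff_C_mul, coeff_X_pow]
  rw [Finset.sum_eq_single k (fun j _ hj => by simp [hj.symm])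
    (fun h => absurd (Finset.mem_range.2 (by omega)) h)]
  simp

theorem littleQJacobi_eq_sum (q : ℝ) (n : ℕ) (a b : ℝ) :
    littleQJacobi q n a b = ∑ k ∈ Finset.range (n + 1),
      C ((qPochhammer (q ^ (-(n : ℤ))) q k * qPochhammer (a * b * q ^ (n + 1)) q k) /
      (qPochhammer (a * q) q k * qPochhammer q q k) * q ^ k) * X ^ k := by
  rw [littleQJacobi, qHypergeometric21, Polynomial.sum_comp]
  refine Finset.sum_congr rfl fun k _ => ?_
  simp only [mul_comp, C_comp, X_pow_comp, mul_pow, C_mul, C_pow]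
  ring

theorem degree_littleQJacobi (hq0 : 0 < q) (hq1 : q < 1) (ha : 0 < a * q) (ha1 : a * q < 1)
    (hb : b * q < 1) (n : ℕ) : (littleQJacobi q n a b).degree = n := by
  have hle : (littleQJacobi q n a b).degree ≤ n := by
    rw [littleQJacobi_eq_sum]
    refine (degree_sum_le _ _).trans (Finset.sup_le fun k hk => ?_)
    refine (degree_C_mul_X_pow_le _ _).trans ?_
    exact_mod_cast Nat.lt_succ_iff.1 (Finset.mem_range.1 hk)
  refine le_antisymm hle (le_degree_of_ne_zero ?_)
  rw [coeff_littleQJacobi q n a b n le_rfl]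
  refine mul_ne_zero (div_ne_zero (mul_ne_zero (qPochhammer_q_neg_pow_ne_zero hq0 hq1 le_rfl) ?_)
    (mul_ne_zero (qPochhammer_pos hq0 hq1 ha1 n).ne' (qPochhammer_pos hq0 hq1 hq1 n).ne'))
    (pow_ne_zero _ hq0.ne')
  -- For `n = 0` the parameter is `abq`, which need not be below `1`, but the product is empty.
  rcases n with _ | n
  · rw [qPochhammer_zero]; exact one_ne_zero
  · refine (qPochhammer_pos hq0 hq1 ?_ _).ne'
    have := mul_mul_pow_lt_one hq0 hq1 ha ha1 hb n
    rwa [mul_assoc, ← pow_add, add_comm 2 n] at this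

theorem discreteFunctional_littleQJacobi_mul_X_pow (hq0 : 0 < q) (hq1 : q < 1) (ha : 0 < a * q)
    (ha1 : a * q < 1) (hb : b * q < 1) {n m : ℕ} (hmn : m < n) :
    discreteFunctional (fun j => q ^ j) (littleQJacobiWeight q a b)
      (littleQJacobi q n a b * X ^ m) = 0 := by
  obtain ⟨d, rfl⟩ : ∃ d, n = m + d + 1 := ⟨n - m - 1, by omega⟩
  set n := m + d + 1 with hn
  have hpos : ∀ k, qPochhammer (a * b * q ^ 2) q k ≠ 0 := fun k =>
    (qPochhammer_pos hq0 hq1 (mul_mul_sq_lt_one ha ha1 hb) k).ne'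
  -- `Q(q^k)` collects the `k`-dependent factors left after cancellation between the moment of order
  -- `k + m` and the coefficient of `p_n`; its degree is at most `m + d = n - 1`.
  let Q : ℝ[X] := (∏ j ∈ Finset.range m, (1 - C (a * q * q ^ j) * X)) *
    ∏ j ∈ Finset.range d, (1 - C (a * b * q ^ 2 * q ^ m * q ^ j) * X)
  have hfac : ∀ c : ℝ, (1 - C c * X).natDegree ≤ 1 := fun c => by compute_degree!
  have hQ : Q.natDegree < n := by
    have h1 := natDegree_prod_le (Finset.range m) fun j => (1 - C (a * q * q ^ j) * X)
    have h2 := natDegree_prod_le (Finset.range d)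
      fun j => (1 - C (a * b * q ^ 2 * q ^ m * q ^ j) * X)
    have h3 := Finset.sum_le_card_nsmul (Finset.range m)
      (fun j => (1 - C (a * q * q ^ j) * X).natDegree) 1 fun j _ => hfac _
    have h4 := Finset.sum_le_card_nsmul (Finset.range d)
      (fun j => (1 - C (a * b * q ^ 2 * q ^ m * q ^ j) * X).natDegree) 1 fun j _ => hfac _
    simp only [Finset.card_range, smul_eq_mul, mul_one] at h3 h4
    have : Q.natDegree ≤ m + d := natDegree_mul_le.trans (add_le_add (h1.trans h3) (h2.trans h4))
    omega
  have hQe : ∀ k, Q.eval (q ^ k) = qPochhammer (a * q * q ^ k) q m *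
      qPochhammer (a * b * q ^ 2 * q ^ (k + m)) q d := fun k => by
    simp only [Q, eval_mul, eval_prod, eval_sub, eval_one, eval_C, eval_X, qPochhammer]
    congr 1 <;> refine Finset.prod_congr rfl fun j _ => ?_ <;> ring
  rw [littleQJacobi_eq_sum, Finset.sum_mul,
    (hasMoments_littleQJacobiWeight hq0 hq1 ha ha1 b).map_sum]
  rw [← mul_zero (discreteFunctional (fun j => q ^ j) (littleQJacobiWeight q a b) 1 /
      qPochhammer (a * b * q ^ 2) q (m + d)), ← sum_qBinomialCoeff_eval_eq_zero hq0 hq1 hQ,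
    Finset.mul_sum]
  refine Finset.sum_congr rfl fun k _ => ?_
  rw [mul_assoc, ← pow_add, discreteFunctional_C_mul, hQe, qBinomialCoeff]
  have hM := littleQJacobi_moment hq0 hq1 ha ha1 b (k + m)
  rw [qPochhammer_add (a * q)] at hM
  -- Both sides equal `(abq²; q)_{m+d+k}`, because `n + 1 = m + d + 2`.
  have hsplit : qPochhammer (a * b * q ^ 2) q (m + d) * qPochhammer (a * b * q ^ (n + 1)) q k =
      qPochhammer (a * b * q ^ 2) q (k + m) *
        qPochhammer (a * b * q ^ 2 * q ^ (k + m)) q d := by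
    rw [← qPochhammer_add, show k + m + d = m + d + k by ring, qPochhammer_add _ _ (m + d)]
    congr 2
    rw [hn]; ring
  have h1 := (qPochhammer_pos hq0 hq1 ha1 k).ne'
  have h2 := (qPochhammer_pos hq0 hq1 hq1 k).ne'
  have h3 := hpos (m + d)
  have h4 := hpos (k + m)
  generalize discreteFunctional (fun j => q ^ j) (littleQJacobiWeight q a b) (X ^ (k + m)) = M at *
  generalize discreteFunctional (fun j => q ^ j) (littleQJacobiWeight q a b) 1 = M0 at *
  generalize qPochhammer (a * q) q k = A at *
  generalize qPochhammer q q k = B at *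
  generalize qPochhammer (a * b * q ^ 2) q (m + d) = D at *
  generalize qPochhammer (a * b * q ^ 2) q (k + m) = E at *
  generalize qPochhammer (a * b * q ^ (n + 1)) q k = G at *
  generalize qPochhammer (a * b * q ^ 2 * q ^ (k + m)) q d = H at *
  generalize qPochhammer (a * q * q ^ k) q m = R at *
  generalize qPochhammer (q ^ (-(n : ℤ))) q k = S at *
  have hG : G = E * H / D := by rw [eq_div_iff h3]; linarith
  have hM' : M = A * R * M0 / E := by rw [eq_div_iff h4]; linarith
  rw [hG, hM']
  field_simp

theorem isOrthogonal_littleQJacobi (hq0 : 0 < q) (hq1 : q < 1) (ha : 0 < a * q)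
    (ha1 : a * q < 1) (hb : b * q < 1) (n : ℕ) :
    IsOrthogonal (fun j => q ^ j) (littleQJacobiWeight q a b) (littleQJacobi q n a b) := by
  intro f hf
  rw [degree_littleQJacobi hq0 hq1 ha ha1 hb] at hf
  by_cases h0 : f = 0
  · rw [h0, mul_zero, discreteFunctional_zero]
  rw [degree_eq_natDegree h0, Nat.cast_lt] at hf
  rw [f.as_sum_range_C_mul_X_pow, Finset.mul_sum,
    (hasMoments_littleQJacobiWeight hq0 hq1 ha ha1 b).map_sum]
  refine Finset.sum_eq_zero fun m hm => ?_
  rw [mul_left_comm, discreteFunctional_C_mul, discreteFunctional_littleQJacobi_mul_X_pow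
    hq0 hq1 ha ha1 hb ((Nat.lt_succ_iff.1 (Finset.mem_range.1 hm)).trans_lt hf), mul_zero]

theorem realRooted_littleQJacobi (hq0 : 0 < q) (hq1 : q < 1) (ha : 0 < a * q)
    (ha1 : a * q < 1) (hb : b * q < 1) (n : ℕ) : RealRooted n (littleQJacobi q n a b) := by
  have hd := degree_littleQJacobi hq0 hq1 ha ha1 hb n
  refine ⟨hd, (isOrthogonal_littleQJacobi hq0 hq1 ha ha1 hb n).splits
    (hasMoments_littleQJacobiWeight hq0 hq1 ha ha1 b)
    (pow_right_strictAnti₀ hq0 hq1).injective (littleQJacobiWeight_pos hq0 hq1 ha hb) ?_⟩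
  rintro h
  simp [h] at hd

/-! ### Comparison of the weights and monotonicity in the parameters. -/

theorem orderedZero_littleQJacobi_lt {a' b' : ℝ} (hq0 : 0 < q) (hq1 : q < 1) (ha : 0 < a * q)
    (ha1 : a * q < 1) (hb : b * q < 1) (ha' : 0 < a' * q) (ha1' : a' * q < 1) (hb' : b' * q < 1)
    (hr : StrictAnti fun j => littleQJacobiWeight q a' b' j / littleQJacobiWeight q a b j)
    {n k : ℕ} (hk : k < n) :
    orderedZero (littleQJacobi q n a b) k < orderedZero (littleQJacobi q n a' b') k :=
  orderedZero_lt_orderedZero (pow_right_strictAnti₀ hq0 hq1)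
    (hasMoments_littleQJacobiWeight hq0 hq1 ha ha1 b)
    (hasMoments_littleQJacobiWeight hq0 hq1 ha' ha1' b')
    (littleQJacobiWeight_pos hq0 hq1 ha hb) (littleQJacobiWeight_pos hq0 hq1 ha' hb') hr
    (degree_littleQJacobi hq0 hq1 ha ha1 hb n) (degree_littleQJacobi hq0 hq1 ha' ha1' hb' n)
    (isOrthogonal_littleQJacobi hq0 hq1 ha ha1 hb n)
    (isOrthogonal_littleQJacobi hq0 hq1 ha' ha1' hb' n) hk

/-- The denominator is free of `a` and `b`, so comparing two weights reduces to comparing the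
numerators. -/
theorem littleQJacobiWeight_succ (hq0 : 0 < q) (hq1 : q < 1) (a b : ℝ) (j : ℕ) :
    littleQJacobiWeight q a b (j + 1) =
      littleQJacobiWeight q a b j * (a * q * (1 - b * q * q ^ j) / (1 - q ^ (j + 1))) := by
  have h := one_sub_pow_succ_ne_zero hq0 hq1 j
  rw [mul_div_assoc', eq_div_iff h, littleQJacobiWeight, littleQJacobiWeight]
  linear_combination (a * q) ^ (j + 1) * qBinomialCoeff_succ hq0 hq1 (b * q) j

theorem one_sub_mul_pow_pos (hq0 : 0 < q) (hq1 : q < 1) (hb : b * q < 1) (j : ℕ) :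
    0 < 1 - b * q * q ^ j := by
  have h0 : 0 < q ^ j := pow_pos hq0 j
  have h1 : q ^ j ≤ 1 := pow_le_one₀ hq0.le hq1.le
  rcases le_or_gt (b * q) 0 with h | h <;> nlinarith

/-- The ratio of two little `q`-Jacobi weights decreases as soon as the ratio of consecutive masses
does. -/
theorem strictAnti_littleQJacobiWeight_div {a' b' : ℝ} (hq0 : 0 < q) (hq1 : q < 1)
    (ha : 0 < a * q) (hb : b * q < 1) (ha' : 0 < a' * q) (hb' : b' * q < 1)
    (h : ∀ j : ℕ, a' * q * (1 - b' * q * q ^ j) < a * q * (1 - b * q * q ^ j)) :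
    StrictAnti fun j => littleQJacobiWeight q a' b' j / littleQJacobiWeight q a b j := by
  refine strictAnti_nat_of_succ_lt fun j => ?_
  have hw := littleQJacobiWeight_pos hq0 hq1 ha hb j
  have hW := littleQJacobiWeight_pos hq0 hq1 ha' hb' j
  rw [div_lt_div_iff₀ (littleQJacobiWeight_pos hq0 hq1 ha hb _) hw,
    littleQJacobiWeight_succ hq0 hq1, littleQJacobiWeight_succ hq0 hq1, mul_right_comm,
    ← mul_assoc]
  refine mul_lt_mul_of_pos_left ?_ (mul_pos hW hw)
  exact div_lt_div_of_pos_right (h j) (sub_pos.2 (pow_lt_one₀ hq0.le hq1 (Nat.succ_ne_zero j)))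

theorem orderedZero_littleQJacobi_lt_of_lt_right {b' : ℝ} (hq0 : 0 < q) (hq1 : q < 1)
    (ha : 0 < a * q) (ha1 : a * q < 1) (hb' : b' * q < 1) (h : b < b') {n k : ℕ} (hk : k < n) :
    orderedZero (littleQJacobi q n a b) k < orderedZero (littleQJacobi q n a b') k := by
  have hb : b * q < 1 := (mul_lt_mul_of_pos_right h hq0).trans hb'
  refine orderedZero_littleQJacobi_lt hq0 hq1 ha ha1 hb ha ha1 hb'
    (strictAnti_littleQJacobiWeight_div hq0 hq1 ha hb ha hb' fun j => ?_) hk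
  have : b * q * q ^ j < b' * q * q ^ j :=
    mul_lt_mul_of_pos_right (mul_lt_mul_of_pos_right h hq0) (pow_pos hq0 j)
  exact mul_lt_mul_of_pos_left (by linarith) ha

theorem orderedZero_littleQJacobi_lt_of_lt_left {a' : ℝ} (hq0 : 0 < q) (hq1 : q < 1)
    (ha : 0 < a * q) (ha1' : a' * q < 1) (hb : b * q < 1) (h : a < a') {n k : ℕ} (hk : k < n) :
    orderedZero (littleQJacobi q n a' b) k < orderedZero (littleQJacobi q n a b) k := by
  have haa : a * q < a' * q := mul_lt_mul_of_pos_right h hq0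
  -- The larger parameter `a'` gives the reference measure and `a` the tilted one: a smaller `a`
  -- makes the masses decay faster towards the node limit `0`.
  refine orderedZero_littleQJacobi_lt hq0 hq1 (ha.trans haa) ha1' hb ha (haa.trans ha1') hb
    (strictAnti_littleQJacobiWeight_div hq0 hq1 (ha.trans haa) hb ha hb fun j => ?_) hk
  exact mul_lt_mul_of_pos_right haa (one_sub_mul_pow_pos hq0 hq1 hb j)

end

theorem theorem1 (q : ℝ) (hq0 : 0 < q) (hq1 : q < 1) (n : ℕ) :
    -- all the zeros are real, so that they can be listed in increasing order
    (∀ a b : ℝ, 0 < a * q → a * q < 1 → b * q < 1 → RealRooted n (littleQJacobi q n a b)) ∧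
    -- each zero is increasing with respect to `b`
    (∀ a : ℝ, 0 < a * q → a * q < 1 → ∀ k < n,
      StrictMonoOn (fun b : ℝ => orderedZero (littleQJacobi q n a b) k) {b : ℝ | b * q < 1}) ∧
    -- each zero is decreasing with respect to `a`
    (∀ b : ℝ, b * q < 1 → ∀ k < n,
      StrictAntiOn (fun a : ℝ => orderedZero (littleQJacobi q n a b) k)
        {a : ℝ | 0 < a * q ∧ a * q < 1}) ∧
    -- the formulation through the partial order
    (∀ a₁ a₂ b₁ b₂ : ℝ, 0 < a₁ → a₁ < a₂ → a₂ < 1 / q → b₁ < b₂ → b₂ < 1 / q →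
      ZerosLE n (littleQJacobi q n a₂ b₁) (littleQJacobi q n a₁ b₁) ∧
      ZerosLE n (littleQJacobi q n a₁ b₁) (littleQJacobi q n a₁ b₂)) := by
  refine ⟨fun a b ha ha1 hb => realRooted_littleQJacobi hq0 hq1 ha ha1 hb n,
    fun a ha ha1 k hk b _ b' hb' h =>
      orderedZero_littleQJacobi_lt_of_lt_right hq0 hq1 ha ha1 hb' h hk,
    fun b hb k hk a ha a' ha' h =>
      orderedZero_littleQJacobi_lt_of_lt_left hq0 hq1 ha.1 ha'.2 hb h hk,
    fun a₁ a₂ b₁ b₂ h0 ha ha2 hb hb2 => ?_⟩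
  rw [lt_div_iff₀ hq0] at ha2 hb2
  have h1 : 0 < a₁ * q := mul_pos h0 hq0
  have h2 : a₁ * q < a₂ * q := mul_lt_mul_of_pos_right ha hq0
  have h3 : b₁ * q < b₂ * q := mul_lt_mul_of_pos_right hb hq0
  have hr := realRooted_littleQJacobi hq0 hq1 h1 (h2.trans ha2) (h3.trans hb2) n
  exact ⟨⟨realRooted_littleQJacobi hq0 hq1 (h1.trans h2) ha2 (h3.trans hb2) n, hr, fun k hk =>
      (orderedZero_littleQJacobi_lt_of_lt_left hq0 hq1 h1 ha2 (h3.trans hb2) ha hk).le⟩,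
    hr, realRooted_littleQJacobi hq0 hq1 h1 (h2.trans ha2) hb2 n, fun k hk =>
      (orderedZero_littleQJacobi_lt_of_lt_right hq0 hq1 h1 (h2.trans ha2) hb2 hb hk).le⟩
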